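/- An interval order is a finite poset $P$ whose points $p$ can be represented by closed bounded real intervals $I(p)$ such that $p<q$ in $P$ if and only if $I(p)$ lies entirely to the left of $I(q)$; a semiorder is an interval order that has such a representation in which all intervals have the same length. For a finite sequence of integers let $\operatorname{asc}(x_1,\dots,x_i)=|\{1\le j<i : x_j<x_{j+1}\}|$. An ascent sequence is a sequence $(x_1,\dots,x_n)$, $n\ge 1$, of integers with $x_1=0$ and $0\le x_i\le 1+\operatorname{asc}(x_1,\dots,x_{i-1})$ for $2\le i\le n$. To each ascent sequence $x$ assign a finite family (repetitions allowed) of intervals $[a,b]$ with nonnegative integer endpoints as follows. To $(0)$ assign $\{[0,0]\}$. If $\mathcal Q$ is assigned to $(x_1,\dots,x_{n-1})$, let $\ell$ be the largest right endpoint of an interval in $\mathcal Q$, let $\ell^*$ be the smallest left endpoint of an interval of $\mathcal Q$ with right endpoint $\ell$, and let $i=x_n$. * If $i\le \ell^*$, add the interval $[i,\ell]$. * If $i=\ell+1$, add the interval $[\ell+1,\ell+1]$. * If $\ell^*<i\le\ell$, replace each $[a,b]$ in $\mathcal Q$ by $[a,b+1]$ if $a<i\le b<\ell$, by $[a+1,b+1]$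 if $i\le a$, and by $[a,i]$ if $a<i$ and $b=\ell$, leave it unchanged if $b<i$, and then add the interval $[i,\ell+1]$. Let $\Psi^{-1}(x)$ be the interval order represented by the family assigned to $x$. (By a theorem of Bousquet-Mélou, Claesson, Dukes and Kitaev, this is a bijection from ascent sequences of length $n$ to isomorphism classes of interval orders on $n$ points.) A semiorder $P$ on $n\ge 1$ points is hereditary if, for the ascent sequence $(x_1,\dots,x_n)$ with $\Psi^{-1}((x_1,\dots,x_n))\cong P$, the interval order $\Psi^{-1}((x_1,\dots,x_i))$ is a semiorder for every $1\le i\le n$. **Theorem.** Let $h_n$ be the number of hereditary semiorders on $n$ points, counted up to isomorphism. Then, as formal power series, $$H(x)=\sum_{n\ge 1}h_n x^n=\frac{x^5-9x^4+12x^3-6x^2+x}{1-x^5+14x^4-29x^3+23x^2-8x}.$$ -/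

import Mathlib

namespace SemiorderGF

/-- A poset is a semiorder if it has a representation by closed bounded real intervals
`[l x, r x]`, all of the same length, with `x < y` iff the interval of `x` lies entirely to the
left of the interval of `y`. -/
def IsSemiorder (α : Type*) [PartialOrder α] : Prop :=
  ∃ l r : α → ℝ, (∀ x, l x ≤ r x) ∧ (∀ x y, x < y ↔ r x < l y) ∧ ∃ c : ℝ, ∀ x, r x - l x = c

/-- The number of ascents of a finite sequence. -/
def asc : List ℕ → ℕ
  | a :: b :: t => (if a < b then 1 else 0) + asc (b :: t)
  | _ => 0

/-- Ascent sequences `(x₁, …, xₙ)`, `n ≥ 1`: `x₁ = 0` and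
`0 ≤ xᵢ ≤ 1 + asc (x₁, …, xᵢ₋₁)` for `2 ≤ i ≤ n` (list indices are shifted by one). -/
def IsAscentSequence (x : List ℕ) : Prop :=
  x.head? = some 0 ∧ ∀ (i : ℕ) (hi : i < x.length), 1 ≤ i → x[i] ≤ 1 + asc (x.take i)

/-! A finite family of intervals `[a, b]` with integer endpoints is given as a list of
pairs `(a, b)`; repeated intervals are allowed. -/

/-- The largest right endpoint. -/
def maxRight (L : List (ℕ × ℕ)) : ℕ := (L.map Prod.snd).foldr max 0

/-- The smallest left endpoint of an interval whose right endpoint is the largest one. -/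
def minLeft (L : List (ℕ × ℕ)) : ℕ :=
  ((L.filter fun I => I.2 = maxRight L).map Prod.fst).foldr min (maxRight L)

/-- What the insertion of a new endpoint `i` does to an interval already present, where `m` is
the largest right endpoint: intervals reaching `m` from the left of `i` are truncated to end at
`i`, the other intervals with `a < i ≤ b` are stretched, intervals with `i ≤ a` are shifted, and
intervals with `b < i` stay. -/
def adjust (i m : ℕ) (I : ℕ × ℕ) : ℕ × ℕ :=
  if i ≤ I.1 then (I.1 + 1, I.2 + 1)
  else if I.2 = m then (I.1, i)
  else if i ≤ I.2 then (I.1, I.2 + 1)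
  else I

/-- One step of the construction of the minimal endpoint representation from an ascent sequence,
for the new entry `i`. Along an ascent sequence `i ≤ maxRight L + 1` always holds, so that the
second case is the case `i = maxRight L + 1`. -/
def step (L : List (ℕ × ℕ)) (i : ℕ) : List (ℕ × ℕ) :=
  if i ≤ minLeft L then (i, maxRight L) :: L
  else if maxRight L < i then (maxRight L + 1, maxRight L + 1) :: L
  else (i, maxRight L + 1) :: L.map (adjust i (maxRight L))

/-- The intervals attached to an ascent sequence. For the one-term sequence `(0)` this is
`[0, 0]`. -/
def intervals (x : List ℕ) : List (ℕ × ℕ) := x.foldl step []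

theorem intervals_singleton_zero : intervals [0] = [(0, 0)] := rfl

theorem snd_le_maxRight {L : List (ℕ × ℕ)} {I : ℕ × ℕ} (hI : I ∈ L) : I.2 ≤ maxRight L := by
  induction L with
  | nil => simp at hI
  | cons J L ih =>
    rcases List.mem_cons.1 hI with rfl | h
    · simp [maxRight]
    · exact (ih h).trans (by simp [maxRight])

theorem minLeft_le_maxRight (L : List (ℕ × ℕ)) : minLeft L ≤ maxRight L := by
  unfold minLeft
  generalize (L.filter fun I => I.2 = maxRight L).map Prod.fst = M
  induction M with
  | nil => simp
  | cons a M ih => exact (min_le_right _ _).trans ih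

theorem step_valid {L : List (ℕ × ℕ)} (hL : ∀ I ∈ L, I.1 ≤ I.2) (i : ℕ) :
    ∀ I ∈ step L i, I.1 ≤ I.2 := by
  intro I hI
  have hm := minLeft_le_maxRight L
  unfold step at hI
  split_ifs at hI with h1 h2
  · rcases List.mem_cons.1 hI with rfl | h
    · exact h1.trans hm
    · exact hL I h
  · rcases List.mem_cons.1 hI with rfl | h
    · exact le_rfl
    · exact hL I h
  · rcases List.mem_cons.1 hI with rfl | h
    · show i ≤ maxRight L + 1
      omega
    · obtain ⟨J, hJ, rfl⟩ := List.mem_map.1 h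
      have := hL J hJ
      unfold adjust
      split_ifs <;> (try dsimp only) <;> omega

theorem intervals_valid (x : List ℕ) : ∀ I ∈ intervals x, I.1 ≤ I.2 := by
  have key : ∀ (x : List ℕ) (L : List (ℕ × ℕ)), (∀ I ∈ L, I.1 ≤ I.2) →
      ∀ I ∈ x.foldl step L, I.1 ≤ I.2 := by
    intro x
    induction x with
    | nil => intro L hL; exact hL
    | cons i x ih => intro L hL; exact ih _ (step_valid hL i)
  exact key x [] (by simp)

/-- The interval order corresponding to an ascent sequence: its points are the (positions of the)
intervals of the representation. -/
def IntervalOrder (x : List ℕ) : Type := Fin (intervals x).length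

/-- The interval of a point. -/
def IntervalOrder.interval {x : List ℕ} (p : IntervalOrder x) : ℕ × ℕ := (intervals x).get p

theorem IntervalOrder.valid {x : List ℕ} (p : IntervalOrder x) :
    p.interval.1 ≤ p.interval.2 :=
  intervals_valid x _ (List.get_mem _ _)

/-- `p < q` iff the interval of `p` lies entirely to the left of the interval of `q`. -/
instance (x : List ℕ) : PartialOrder (IntervalOrder x) where
  le p q := p = q ∨ p.interval.2 < q.interval.1
  lt p q := p.interval.2 < q.interval.1
  le_refl p := Or.inl rfl
  le_trans p q r := by
    rintro (rfl | h1) (rfl | h2)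
    · exact Or.inl rfl
    · exact Or.inr h2
    · exact Or.inr h1
    · exact Or.inr (h1.trans (q.valid.trans_lt h2))
  lt_iff_le_not_ge p q := by
    constructor
    · intro h
      refine ⟨Or.inr h, ?_⟩
      rintro (rfl | h')
      · exact absurd q.valid (not_le.2 h)
      · have := p.valid
        have := q.valid
        omega
    · rintro ⟨rfl | h, h'⟩
      · exact absurd (Or.inl rfl) h'
      · exact h
  le_antisymm p q := by
    rintro (rfl | h1) (h | h2)
    · rfl
    · rfl
    · exact h.symm
    · have := p.valid
      have := q.valid
      omega

/-- A semiorder is hereditary if, for the ascent sequence `x` that corresponds to it, every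
nonempty initial segment of `x` corresponds to a semiorder. -/
def IsHereditary (α : Type*) [PartialOrder α] : Prop :=
  IsSemiorder α ∧ ∃ x : List ℕ, IsAscentSequence x ∧ Nonempty (α ≃o IntervalOrder x) ∧
    ∀ i, 1 ≤ i → i ≤ x.length → IsSemiorder (IntervalOrder (x.take i))

/-- Isomorphism of partial orders on the point set `Fin n`. -/
def isoSetoid (n : ℕ) : Setoid (PartialOrder (Fin n)) where
  r P Q := Nonempty (@OrderIso (Fin n) (Fin n) P.toLE Q.toLE)
  iseqv :=
    { refl := fun P => ⟨@OrderIso.refl (Fin n) P.toLE⟩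
      symm := fun {P Q} ⟨e⟩ => ⟨@OrderIso.symm (Fin n) (Fin n) P.toLE Q.toLE e⟩
      trans := fun {P Q R} ⟨e⟩ ⟨f⟩ =>
        ⟨@OrderIso.trans (Fin n) (Fin n) (Fin n) P.toLE Q.toLE R.toLE e f⟩ }

/-- The unlabeled (that is, up to isomorphism) hereditary semiorders on `n` points. -/
def hereditaryClasses (n : ℕ) : Set (Quotient (isoSetoid n)) :=
  {q | ∃ P : PartialOrder (Fin n), @IsHereditary (Fin n) P ∧ Quotient.mk (isoSetoid n) P = q}

/-- The number of unlabeled hereditary semiorders on `n` points. Ascent sequences are nonempty,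
so this is `0` for `n = 0`. -/
noncomputable def numHereditary (n : ℕ) : ℕ := (hereditaryClasses n).ncard

/-- The ordinary generating function of the hereditary semiorders, as a formal power series. -/
noncomputable def hereditaryGF : PowerSeries ℚ := PowerSeries.mk fun n => (numHereditary n : ℚ)

end SemiorderGF

/-! The families attached to ascent sequences are minimal representations (`Rep`): every number from
0 to the maximum m occurs both as a left and as a right endpoint. Such a family represents a
semiorder exactly when no interval lies in the interior of another (`isSemiorder_iff_proper`), so
being hereditary means that this holds at every step of the construction.

The construction is governed by two parameters: m is the number of ascents, and p, the smallest left
endpoint matching m, is the last entry (`IsAscentSequence.rep`). A minimal representation can be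
read off from its order, and each step can be undone, so distinct ascent sequences give
non-isomorphic orders (`IsAscentSequence.eq_of_orderIso`). Surjectivity of the bijection is not
needed, because a hereditary semiorder comes with its sequence; counting classes thus becomes
counting sequences (`numHereditary_eq`).

In a proper representation only the entries p - 1, p, p + 1, m, m + 1 can preserve properness. Which
of them do depends on the gap m - p, on whether an interval ending before m starts at p, and on the
intervals ending strictly between p and m or at p. Eight types suffice to record this, and the types
of the successors are determined by the type (`Good.step_of_mem`, `Good.exists_move`). Hereditary
sequences are therefore the walks in a finite automaton with eight states, and eliminating seven
unknowns from the linear system for their generating functions leaves the stated fraction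
(`wordGF_start_mul`). -/

namespace SemiorderGF

/-! ### Proper families and unit intervals -/

/-- No interval of the family lies in the interior of another one. -/
def Proper (L : List (ℕ × ℕ)) : Prop := ∀ I ∈ L, ∀ J ∈ L, I.1 < J.1 → I.2 ≤ J.2

/-- A proper finite set of intervals is order-equivalent to a family of unit intervals. -/
theorem exists_unit_representation (S : Finset (ℕ × ℕ)) (hv : ∀ I ∈ S, I.1 ≤ I.2)
    (hp : ∀ I ∈ S, ∀ J ∈ S, I.1 < J.1 → I.2 ≤ J.2) :
    ∃ t : ℕ × ℕ → ℝ, ∀ I ∈ S, ∀ J ∈ S, (I.2 < J.1 → t I + 1 < t J) ∧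
      (J.1 ≤ I.2 → t J < t I + 1) ∧ (I.1 + I.2 < J.1 + J.2 → t I < t J) := by
  induction S using Finset.induction_on_max_value (fun I : ℕ × ℕ => I.1 + I.2) with
  | empty => exact ⟨fun _ => 0, by simp⟩
  | insert z S hz hmax ih =>
    obtain ⟨t, ht⟩ := ih (fun I hI => hv I (Finset.mem_insert_of_mem hI))
      (fun I hI J hJ => hp I (Finset.mem_insert_of_mem hI) J (Finset.mem_insert_of_mem hJ))
    have hzz := hv z (Finset.mem_insert_self _ _)
    -- Properness and the maximal endpoint sum make z last in both coordinates.
    have hle : ∀ I ∈ S, I.1 ≤ z.1 ∧ I.2 ≤ z.2 := by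
      intro I hI
      have h1 := hp I (Finset.mem_insert_of_mem hI) z (Finset.mem_insert_self _ _)
      have h2 := hp z (Finset.mem_insert_self _ _) I (Finset.mem_insert_of_mem hI)
      have h3 := hmax I hI
      omega
    -- The unit interval of z is to start at r: after every earlier start, after the end of each
    -- interval left of z, and before the end of each interval meeting z. The bounds are compatible
    -- because an interval left of z ends before one meeting z, hence has the smaller endpoint sum.
    obtain ⟨r, hr1, hr2⟩ := Order.exists_between_finsets
      (lo := S.image t ∪ (S.filter fun I => I.2 < z.1).image fun I => t I + 1)
      (hi := (S.filter fun I => z.1 ≤ I.2).image fun I => t I + 1) (by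
        intro x hx y hy
        simp only [Finset.mem_union, Finset.mem_image, Finset.mem_filter] at hx hy
        obtain ⟨J, ⟨hJ, hJz⟩, rfl⟩ := hy
        rcases hx with ⟨I, hI, rfl⟩ | ⟨I, ⟨hI, hIz⟩, rfl⟩
        · exact (ht J hJ I hI).2.1 ((hle I hI).1.trans hJz)
        · have h1 := hp J (Finset.mem_insert_of_mem hJ) I (Finset.mem_insert_of_mem hI)
          have := (ht I hI J hJ).2.2 (by omega)
          linarith)
    simp only [Finset.mem_union, Finset.mem_image, Finset.mem_filter] at hr1 hr2
    have hne : ∀ I ∈ S, I ≠ z := fun I hI h => hz (h ▸ hI)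
    refine ⟨Function.update t z r, ?_⟩
    intro I hI J hJ
    rcases Finset.mem_insert.1 hI with rfl | hI' <;> rcases Finset.mem_insert.1 hJ with rfl | hJ'
    · simp only [Function.update_self]
      refine ⟨fun h => by omega, fun _ => by linarith, fun h => by omega⟩
    · rw [Function.update_self, Function.update_of_ne (hne J hJ')]
      have := hle J hJ'
      have h1 := hr1 (t J) (Or.inl ⟨J, hJ', rfl⟩)
      exact ⟨fun h => by omega, fun _ => by linarith, fun h => by omega⟩
    · rw [Function.update_self, Function.update_of_ne (hne I hI')]
      exact ⟨fun h => hr1 _ (Or.inr ⟨I, ⟨hI', h⟩, rfl⟩), fun h => hr2 _ ⟨I, ⟨hI', h⟩, rfl⟩,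
        fun _ => hr1 _ (Or.inl ⟨I, hI', rfl⟩)⟩
    · rw [Function.update_of_ne (hne J hJ'), Function.update_of_ne (hne I hI')]
      exact ht I hI' J hJ'

theorem IsSemiorder.of_orderIso {α β : Type*} [PartialOrder α] [PartialOrder β] (e : α ≃o β)
    (h : IsSemiorder β) : IsSemiorder α := by
  obtain ⟨l, r, h1, h2, c, h3⟩ := h
  exact ⟨l ∘ e, r ∘ e, fun x => h1 _, fun x y => by rw [← e.lt_iff_lt, h2]; rfl, c,
    fun x => h3 _⟩

/-! ### Minimal representations and the effect of one step -/

/-- A family of intervals in which all numbers `0, …, m` are left endpoints and right endpoints,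
`m` is the largest right endpoint, and `p` is the smallest left endpoint matching it. -/
structure Rep (L : List (ℕ × ℕ)) (m p : ℕ) : Prop where
  valid : ∀ I ∈ L, I.1 ≤ I.2
  le_max : ∀ I ∈ L, I.2 ≤ m
  left : ∀ k ≤ m, ∃ b, (k, b) ∈ L
  right : ∀ k ≤ m, ∃ a, (a, k) ∈ L
  mem : (p, m) ∈ L
  min : ∀ a, (a, m) ∈ L → p ≤ a

theorem Rep.maxRight_eq {L m p} (h : Rep L m p) : maxRight L = m := by
  refine le_antisymm ?_ (snd_le_maxRight h.mem)
  have key : ∀ M : List (ℕ × ℕ), (∀ I ∈ M, I.2 ≤ m) → maxRight M ≤ m := by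
    intro M
    induction M with
    | nil => intro _; exact Nat.zero_le _
    | cons J M ih =>
      intro hM
      exact max_le (hM J (by simp)) (ih fun I hI => hM I (by simp [hI]))
  exact key L h.le_max

theorem le_foldr_min {M : List ℕ} {b p : ℕ} (hb : p ≤ b) (hM : ∀ a ∈ M, p ≤ a) :
    p ≤ M.foldr min b := by
  induction M with
  | nil => exact hb
  | cons a M ih => exact le_min (hM a (by simp)) (ih fun c hc => hM c (by simp [hc]))

theorem foldr_min_le {M : List ℕ} {b p : ℕ} (hM : p ∈ M) : M.foldr min b ≤ p := by
  induction M with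
  | nil => simp at hM
  | cons a M ih =>
    rcases List.mem_cons.1 hM with rfl | h
    · exact min_le_left _ _
    · exact (min_le_right _ _).trans (ih h)

theorem Rep.minLeft_eq {L m p} (h : Rep L m p) : minLeft L = p := by
  unfold minLeft
  rw [h.maxRight_eq]
  apply le_antisymm
  · apply foldr_min_le
    simp only [List.mem_map, List.mem_filter]
    exact ⟨(p, m), ⟨h.mem, by simp⟩, rfl⟩
  · apply le_foldr_min (h.valid _ h.mem)
    intro a ha
    simp only [List.mem_map, List.mem_filter] at ha
    obtain ⟨⟨a', b⟩, ⟨h1, h2⟩, rfl⟩ := ha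
    simp only [decide_eq_true_eq] at h2
    subst h2
    exact h.min _ h1

theorem Rep.fst_le {L m p} (h : Rep L m p) {I} (hI : I ∈ L) : I.1 ≤ m :=
  (h.valid I hI).trans (h.le_max I hI)

theorem IntervalOrder.lt_iff {x : List ℕ} (p q : IntervalOrder x) :
    p < q ↔ p.interval.2 < q.interval.1 := Iff.rfl

theorem IntervalOrder.interval_mem {x : List ℕ} (p : IntervalOrder x) :
    p.interval ∈ intervals x := List.get_mem _ _

theorem IntervalOrder.exists_interval_eq {x : List ℕ} {I : ℕ × ℕ} (hI : I ∈ intervals x) :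
    ∃ p : IntervalOrder x, p.interval = I := by
  obtain ⟨n, hn⟩ := List.get_of_mem hI
  exact ⟨n, hn⟩

/-- If J lies in the interior of I, minimality supplies an interval ending at J.1 - 1 and one
starting at J.2 + 1. With J they form a chain of three whose members are all incomparable to I, so
any real interval for I is longer than the one for J. Conversely, `exists_unit_representation`
applies. -/
theorem isSemiorder_iff_proper {x : List ℕ} {m p : ℕ} (h : Rep (intervals x) m p) :
    IsSemiorder (IntervalOrder x) ↔ Proper (intervals x) := by
  constructor
  · rintro ⟨l, r, h1, h2, c, h3⟩ I hI J hJ hIJ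
    by_contra! hlt
    have hJv := h.valid J hJ
    have hIm := h.le_max I hI
    obtain ⟨u, hu⟩ := h.right (J.1 - 1) (by omega)
    obtain ⟨v, hv⟩ := h.left (J.2 + 1) (by omega)
    obtain ⟨qi, hi⟩ := IntervalOrder.exists_interval_eq hI
    obtain ⟨qj, hj⟩ := IntervalOrder.exists_interval_eq hJ
    obtain ⟨qu, hu⟩ := IntervalOrder.exists_interval_eq hu
    obtain ⟨qv, hv⟩ := IntervalOrder.exists_interval_eq hv
    have e1 := h2 qu qj
    have e2 := h2 qj qv
    have e3 := h2 qu qi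
    have e4 := h2 qi qv
    simp only [IntervalOrder.lt_iff, hi, hj, hu, hv] at e1 e2 e3 e4
    have f1 := e1.1 (by omega)
    have f2 := e2.1 (by omega)
    have f3 := mt e3.2 (by omega)
    have f4 := mt e4.2 (by omega)
    have := h3 qi
    have := h3 qj
    linarith
  · intro hp
    obtain ⟨t, ht⟩ := exists_unit_representation (intervals x).toFinset
      (fun I hI => h.valid I (List.mem_toFinset.1 hI))
      (fun I hI J hJ => hp I (List.mem_toFinset.1 hI) J (List.mem_toFinset.1 hJ))
    refine ⟨fun q => t q.interval, fun q => t q.interval + 1, fun q => by simp, ?_, 1,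
      fun q => by simp⟩
    intro q s
    have hs := ht q.interval (List.mem_toFinset.2 q.interval_mem) s.interval
      (List.mem_toFinset.2 s.interval_mem)
    rw [IntervalOrder.lt_iff]
    refine ⟨hs.1, fun h' => ?_⟩
    by_contra! hle
    exact absurd (hs.2.1 hle) (not_lt.2 h'.le)

theorem Rep.step_low {L m p} (h : Rep L m p) {i : ℕ} (hi : i ≤ p) : step L i = (i, m) :: L := by
  simp [step, h.minLeft_eq, h.maxRight_eq, hi]

theorem Rep.step_top {L m p} (h : Rep L m p) : step L (m + 1) = (m + 1, m + 1) :: L := by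
  have := h.valid _ h.mem
  simp only at this
  simp only [step, h.minLeft_eq, h.maxRight_eq]
  rw [if_neg (by omega), if_pos (by omega)]

theorem Rep.step_mid {L m p} (h : Rep L m p) {i : ℕ} (hi : p < i) (hm : i ≤ m) :
    step L i = (i, m + 1) :: L.map (adjust i m) := by
  simp only [step, h.minLeft_eq, h.maxRight_eq]
  rw [if_neg (by omega), if_neg (by omega)]

theorem adjust_of_le {i m a b : ℕ} (h : i ≤ a) : adjust i m (a, b) = (a + 1, b + 1) := by
  simp [adjust, h]

theorem adjust_of_eq {i m a : ℕ} (h : a < i) : adjust i m (a, m) = (a, i) := by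
  simp [adjust, h]

theorem adjust_of_lt_le {i m a b : ℕ} (h : a < i) (hb : i ≤ b) (hm : b < m) :
    adjust i m (a, b) = (a, b + 1) := by
  simp [adjust, h, hb, hm.ne]

theorem adjust_of_lt {i m a b : ℕ} (h : b < i) (hab : a ≤ b) (hm : i ≤ m) :
    adjust i m (a, b) = (a, b) := by
  have h1 : ¬ i ≤ a := by omega
  have h2 : ¬ i ≤ b := by omega
  have h3 : b ≠ m := by omega
  simp [adjust, h1, h2, h3]

theorem adjust_cases {i m a b : ℕ} (hab : a ≤ b) (hb : b ≤ m) (hi : i ≤ m) :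
    (i ≤ a ∧ adjust i m (a, b) = (a + 1, b + 1)) ∨
    (a < i ∧ b = m ∧ adjust i m (a, b) = (a, i)) ∨
    (a < i ∧ i ≤ b ∧ b < m ∧ adjust i m (a, b) = (a, b + 1)) ∨
    (b < i ∧ adjust i m (a, b) = (a, b)) := by
  rcases le_or_gt i a with h | h
  · exact Or.inl ⟨h, adjust_of_le h⟩
  · rcases eq_or_lt_of_le hb with rfl | h'
    · exact Or.inr (Or.inl ⟨h, rfl, adjust_of_eq h⟩)
    · rcases le_or_gt i b with h2 | h2
      · exact Or.inr (Or.inr (Or.inl ⟨h, h2, h', adjust_of_lt_le h h2 h'⟩))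
      · exact Or.inr (Or.inr (Or.inr ⟨h2, adjust_of_lt h2 hab hi⟩))

/-- The five alternatives are the origins of an interval: new, shifted, truncated, stretched,
unchanged. Later case distinctions follow this order. -/
theorem Rep.mem_step_mid {L m p} (h : Rep L m p) {i c d : ℕ} (hi : p < i) (hm : i ≤ m) :
    (c, d) ∈ step L i ↔ (c = i ∧ d = m + 1) ∨ (∃ a b, (a, b) ∈ L ∧ i ≤ a ∧ c = a + 1 ∧ d = b + 1) ∨
      ((c, m) ∈ L ∧ c < i ∧ d = i) ∨ (∃ b, (c, b) ∈ L ∧ c < i ∧ i ≤ b ∧ b < m ∧ d = b + 1) ∨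
      ((c, d) ∈ L ∧ d < i) := by
  rw [h.step_mid hi hm, List.mem_cons, List.mem_map, Prod.mk.injEq]
  refine or_congr Iff.rfl ?_
  constructor
  · rintro ⟨⟨a, b⟩, hI, he⟩
    have h1 := h.valid _ hI
    have h2 := h.le_max _ hI
    rcases adjust_cases h1 h2 hm with ⟨h3, h4⟩ | ⟨h3, rfl, h4⟩ | ⟨h3, h5, h6, h4⟩ | ⟨h3, h4⟩ <;>
      rw [h4, Prod.mk.injEq] at he <;> obtain ⟨rfl, rfl⟩ := he
    · exact Or.inl ⟨a, b, hI, h3, rfl, rfl⟩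
    · exact Or.inr (Or.inl ⟨hI, h3, rfl⟩)
    · exact Or.inr (Or.inr (Or.inl ⟨b, hI, h3, h5, h6, rfl⟩))
    · exact Or.inr (Or.inr (Or.inr ⟨hI, h3⟩))
  · rintro (⟨a, b, hI, h3, rfl, rfl⟩ | ⟨hI, h3, rfl⟩ | ⟨b, hI, h3, h5, h6, rfl⟩ | ⟨hI, h3⟩)
    · exact ⟨_, hI, adjust_of_le h3⟩
    · exact ⟨_, hI, adjust_of_eq h3⟩
    · exact ⟨_, hI, adjust_of_lt_le h3 h5 h6⟩
    · exact ⟨_, hI, adjust_of_lt h3 (h.valid _ hI) hm⟩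

theorem rep_zero : Rep [(0, 0)] 0 0 := by
  constructor <;> simp

theorem Rep.low {L m p} (h : Rep L m p) {i : ℕ} (hi : i ≤ p) : Rep (step L i) m i := by
  have hpm := h.valid _ h.mem
  simp only at hpm
  rw [h.step_low hi]
  refine ⟨?_, ?_, fun k hk => ?_, fun k hk => ?_, by simp, ?_⟩
  · simpa using ⟨hi.trans hpm, fun a b => h.valid (a, b)⟩
  · simpa using fun a b => h.le_max (a, b)
  · obtain ⟨b, hb⟩ := h.left k hk
    exact ⟨b, by simp [hb]⟩
  · obtain ⟨b, hb⟩ := h.right k hk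
    exact ⟨b, by simp [hb]⟩
  · intro a ha
    rcases List.mem_cons.1 ha with h' | h'
    · exact (Prod.mk.inj h').1.ge
    · exact hi.trans (h.min a h')

theorem Rep.top {L m p} (h : Rep L m p) : Rep (step L (m + 1)) (m + 1) (m + 1) := by
  rw [h.step_top]
  refine ⟨?_, ?_, fun k hk => ?_, fun k hk => ?_, by simp, ?_⟩
  · simpa using fun a b => h.valid (a, b)
  · simpa using fun a b hab => (h.le_max (a, b) hab).trans (Nat.le_succ m)
  · rcases eq_or_lt_of_le hk with rfl | hk
    · exact ⟨m + 1, by simp⟩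
    · obtain ⟨b, hb⟩ := h.left k (by omega)
      exact ⟨b, by simp [hb]⟩
  · rcases eq_or_lt_of_le hk with rfl | hk
    · exact ⟨m + 1, by simp⟩
    · obtain ⟨b, hb⟩ := h.right k (by omega)
      exact ⟨b, by simp [hb]⟩
  · intro a ha
    rcases List.mem_cons.1 ha with h' | h'
    · exact (Prod.mk.inj h').1.ge
    · exact absurd (h.le_max _ h') (by simp)

/-- Stretching and shifting make room for one more endpoint value. The value i stays a left endpoint
through the new interval and a right endpoint through the truncation of [p, m]. -/
theorem Rep.mid {L m p} (h : Rep L m p) {i : ℕ} (hi : p < i) (hm : i ≤ m) :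
    Rep (step L i) (m + 1) i := by
  refine ⟨step_valid h.valid i, ?_, fun k hk => ?_, fun k hk => ?_, ?_, ?_⟩
  · rintro ⟨c, d⟩ hI
    rw [h.mem_step_mid hi hm] at hI
    show d ≤ m + 1
    rcases hI with ⟨_, _⟩ | ⟨a, b, h1, _, _, _⟩ | ⟨_, _⟩ | ⟨b, _, _⟩ | ⟨_, _⟩ <;> try omega
    have := h.le_max _ h1
    simp only at this
    omega
  · rcases lt_trichotomy k i with hk' | rfl | hk'
    · obtain ⟨b, hb⟩ := h.left k (by omega)
      have h1 := h.valid _ hb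
      have h2 := h.le_max _ hb
      refine ⟨(adjust i m (k, b)).2, ?_⟩
      rw [h.step_mid hi hm]
      refine List.mem_cons_of_mem _ (List.mem_map.2 ⟨(k, b), hb, Prod.ext ?_ rfl⟩)
      rcases adjust_cases h1 h2 hm with h' | h' | h' | h' <;> simp [h'] <;> omega
    · exact ⟨m + 1, by simp [h.mem_step_mid hi hm]⟩
    · obtain ⟨b, hb⟩ := h.left (k - 1) (by omega)
      refine ⟨b + 1, (h.mem_step_mid hi hm).2 (Or.inr (Or.inl ⟨k - 1, b, hb, ?_⟩))⟩
      omega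
  · rcases lt_trichotomy k i with hk' | rfl | hk'
    · obtain ⟨a, ha⟩ := h.right k (by omega)
      exact ⟨a, by simp [h.mem_step_mid hi hm, ha, hk']⟩
    · exact ⟨p, by simp [h.mem_step_mid hi hm, hi, h.mem]⟩
    · rcases eq_or_lt_of_le hk with rfl | hk
      · exact ⟨i, by simp [h.mem_step_mid hi hm]⟩
      · obtain ⟨a, ha⟩ := h.right (k - 1) (by omega)
        rcases le_or_gt i a with h1 | h1
        · refine ⟨a + 1, (h.mem_step_mid hi hm).2 (Or.inr (Or.inl ⟨a, k - 1, ha, ?_⟩))⟩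
          omega
        · refine ⟨a, (h.mem_step_mid hi hm).2
            (Or.inr (Or.inr (Or.inr (Or.inl ⟨k - 1, ha, ?_⟩))))⟩
          omega
  · simp [h.mem_step_mid hi hm]
  · intro a ha
    rw [h.mem_step_mid hi hm] at ha
    rcases ha with ⟨_, _⟩ | ⟨a, b, h1, _, _, _⟩ | ⟨_, _⟩ | ⟨b, _, _⟩ | ⟨_, _⟩ <;> omega

/-- The largest endpoint after a step with new entry `i`. -/
def nextMax (m p i : ℕ) : ℕ := m + if p < i then 1 else 0

/-- Since p is the previous entry, p < i says that i creates an ascent; hence m counts ascents and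
the bound on entries reads i ≤ m + 1. -/
theorem Rep.step {L m p} (h : Rep L m p) {i : ℕ} (hi : i ≤ m + 1) :
    Rep (step L i) (nextMax m p i) i := by
  have hpm := h.valid _ h.mem
  simp only at hpm
  unfold nextMax
  rcases le_or_gt i p with h1 | h1
  · simpa [h1.not_gt] using h.low h1
  · rw [if_pos h1]
    rcases eq_or_lt_of_le hi with rfl | h2
    · exact h.top
    · exact h.mid h1 (by omega)

/-! ### Reversibility of a step -/

theorem Rep.unique {L L' m p m' p'} (h : Rep L m p) (h' : Rep L' m' p') (e : L.Perm L') :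
    m = m' ∧ p = p' := by
  have hm : m = m' := le_antisymm (h'.le_max _ (e.mem_iff.1 h.mem))
    (h.le_max _ (e.mem_iff.2 h'.mem))
  subst hm
  exact ⟨rfl, le_antisymm (h.min _ (e.mem_iff.2 h'.mem)) (h'.min _ (e.mem_iff.1 h.mem))⟩

/-- The image reveals which rule was used: only shifted intervals start after i, and the truncated,
stretched and unchanged ones end at, after and before i. -/
theorem adjust_injOn {i m : ℕ} (hi : i ≤ m) {I J : ℕ × ℕ} (hI : I.1 ≤ I.2) (hJ : J.1 ≤ J.2)
    (hIm : I.2 ≤ m) (hJm : J.2 ≤ m) (h : adjust i m I = adjust i m J) : I = J := by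
  obtain ⟨a, b⟩ := I
  obtain ⟨c, d⟩ := J
  rcases adjust_cases hI hIm hi with ⟨_, h1⟩ | ⟨_, _, h1⟩ | ⟨_, _, _, h1⟩ | ⟨_, h1⟩ <;>
  rcases adjust_cases hJ hJm hi with ⟨_, h2⟩ | ⟨_, _, h2⟩ | ⟨_, _, _, h2⟩ | ⟨_, h2⟩ <;>
  rw [h1, h2, Prod.mk.injEq] at h <;> ext <;> simp only at * <;> omega

theorem perm_of_map_perm {α β : Type*} {f : α → β} {s : Set α} (hf : Set.InjOn f s)
    {L L' : List α} (hL : ∀ a ∈ L, a ∈ s) (hL' : ∀ a ∈ L', a ∈ s)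
    (h : (L.map f).Perm (L'.map f)) : L.Perm L' := by
  rcases isEmpty_or_nonempty α with hα | hα
  · rw [List.eq_nil_iff_forall_not_mem.2 fun a (_ : a ∈ L) => hα.elim a,
      List.eq_nil_iff_forall_not_mem.2 fun a (_ : a ∈ L') => hα.elim a]
  · have hg := hf.leftInvOn_invFunOn
    have key : ∀ M : List α, (∀ a ∈ M, a ∈ s) → (M.map f).map (Function.invFunOn f s) = M := by
      intro M hM
      rw [List.map_map]
      conv_rhs => rw [← List.map_id M]
      exact List.map_congr_left fun a ha => hg (hM a ha)
    have := h.map (Function.invFunOn f s)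
    rwa [key L hL, key L' hL'] at this

/-- After a step with an ascent, the new entry is the left endpoint of exactly one interval. -/
theorem Rep.eq_of_mem_step {L m p} (h : Rep L m p) {i : ℕ} (hi : i ≤ m + 1) (hp : p < i) :
    ∃ L', SemiorderGF.step L i = (i, m + 1) :: L' ∧ ∀ b, (i, b) ∉ L' := by
  rcases eq_or_lt_of_le hi with rfl | h2
  · refine ⟨L, h.step_top, fun b hb => ?_⟩
    have := h.fst_le hb
    simp only at this
    omega
  · refine ⟨_, h.step_mid hp (by omega), fun b hb => ?_⟩
    obtain ⟨⟨c, d⟩, hI, he⟩ := List.mem_map.1 hb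
    rcases adjust_cases (h.valid _ hI) (h.le_max _ hI) (show i ≤ m by omega) with
      ⟨_, h1⟩ | ⟨_, _, h1⟩ | ⟨_, _, _, h1⟩ | ⟨_, h1⟩ <;> rw [h1, Prod.mk.injEq] at he
    · omega
    · omega
    · omega
    · have := h.valid _ hI
      simp only at this
      omega

/-- After a step without ascent, i is the left endpoint of the new interval and of an old one; after
an ascent it belongs to the new interval alone. -/
theorem step_perm_not_lt {L L' m p m' p' i} (h : Rep L m p) (h' : Rep L' m' p')
    (hi : i ≤ m + 1) (hi' : i ≤ m' + 1) (e : (step L i).Perm (step L' i)) (hp : i ≤ p)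
    (hp' : p' < i) : False := by
  obtain ⟨M, hM, hM'⟩ := h'.eq_of_mem_step hi' hp'
  have hm := ((h.step hi).unique (h'.step hi') e).1
  simp only [nextMax, if_pos hp', if_neg hp.not_gt, add_zero] at hm
  rw [hM, h.step_low hp, hm] at e
  have hpm := h.valid _ h.mem
  obtain ⟨b, hb⟩ := h.left i (hp.trans hpm)
  exact hM' b (((List.perm_cons _).1 e).mem_iff.1 hb)

/-- The entry is recovered as the parameter p of the result, and the multiplicity of i as a left
endpoint tells whether there was an ascent. It then remains to cancel the new interval and, where
intervals were adjusted, to use injectivity of `adjust`. -/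
theorem step_perm_injective {L L' m p m' p' i j} (h : Rep L m p) (h' : Rep L' m' p')
    (hi : i ≤ m + 1) (hj : j ≤ m' + 1) (e : (step L i).Perm (step L' j)) :
    i = j ∧ L.Perm L' := by
  obtain ⟨hm, rfl⟩ := (h.step hi).unique (h'.step hj) e
  refine ⟨rfl, ?_⟩
  rcases le_or_gt i p with h1 | h1 <;> rcases le_or_gt i p' with h2 | h2
  · simp only [nextMax, if_neg h1.not_gt, if_neg h2.not_gt, add_zero] at hm
    subst hm
    rw [h.step_low h1, h'.step_low h2] at e
    exact (List.perm_cons _).1 e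
  · exact (step_perm_not_lt h h' hi hj e h1 h2).elim
  · exact (step_perm_not_lt h' h hj hi e.symm h2 h1).elim
  · simp only [nextMax, if_pos h1, if_pos h2, add_left_inj] at hm
    subst hm
    rcases eq_or_lt_of_le hi with rfl | h3
    · rw [h.step_top, h'.step_top] at e
      exact (List.perm_cons _).1 e
    · rw [h.step_mid h1 (by omega), h'.step_mid h2 (by omega)] at e
      refine perm_of_map_perm (s := {I | I.1 ≤ I.2 ∧ I.2 ≤ m})
        (fun I hI J hJ => adjust_injOn (by omega) hI.1 hJ.1 hI.2 hJ.2)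
        (fun I hI => ⟨h.valid I hI, h.le_max I hI⟩)
        (fun I hI => ⟨h'.valid I hI, h'.le_max I hI⟩) ((List.perm_cons _).1 e)

/-! ### The order determines its minimal representation -/

section Canonical

variable {x y : List ℕ} {m p m' p' : ℕ}

/-- Every number up to m is a right endpoint, so a larger left endpoint gives a strictly larger set
of predecessors. This describes the comparison of left endpoints by the order alone. -/
theorem interval_fst_le_iff (h : Rep (intervals x) m p) (s t : IntervalOrder x) :
    s.interval.1 ≤ t.interval.1 ↔ ∀ r, r < s → r < t := by
  constructor
  · intro hst r hr
    rw [IntervalOrder.lt_iff] at hr ⊢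
    exact hr.trans_le hst
  · intro H
    by_contra! hlt
    obtain ⟨c, hc⟩ := h.right t.interval.1 (h.fst_le t.interval_mem)
    obtain ⟨r, hr⟩ := IntervalOrder.exists_interval_eq hc
    have := H r (by rw [IntervalOrder.lt_iff, hr]; exact hlt)
    rw [IntervalOrder.lt_iff, hr] at this
    exact lt_irrefl _ this

/-- Left endpoints fill 0, …, m without gaps and an isomorphism preserves their comparison, so
climbing one value at a time raises the image by at least one each time. -/
theorem interval_fst_le_map (hx : Rep (intervals x) m p) (hy : Rep (intervals y) m' p')
    (e : IntervalOrder x ≃o IntervalOrder y) (s : IntervalOrder x) :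
    s.interval.1 ≤ (e s).interval.1 := by
  have hle : ∀ s t : IntervalOrder x,
      (e s).interval.1 ≤ (e t).interval.1 → s.interval.1 ≤ t.interval.1 := by
    intro s t hst
    rw [interval_fst_le_iff hx]
    intro r hr
    rw [← e.lt_iff_lt] at hr ⊢
    exact (interval_fst_le_iff hy _ _).1 hst _ hr
  have key : ∀ n (s : IntervalOrder x), n ≤ s.interval.1 → n ≤ (e s).interval.1 := by
    intro n
    induction n with
    | zero => intros; exact Nat.zero_le _
    | succ n ih =>
      intro s hs
      obtain ⟨b, hb⟩ := hx.left n ((Nat.le_succ n).trans (hs.trans (hx.fst_le s.interval_mem)))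
      obtain ⟨t, ht⟩ := IntervalOrder.exists_interval_eq hb
      have h1 := ih t (by rw [ht])
      have h2 := mt (hle s t) (by rw [ht]; simpa using hs)
      omega
  exact key _ s le_rfl

theorem interval_fst_map (hx : Rep (intervals x) m p) (hy : Rep (intervals y) m' p')
    (e : IntervalOrder x ≃o IntervalOrder y) (s : IntervalOrder x) :
    (e s).interval.1 = s.interval.1 :=
  le_antisymm (by simpa using interval_fst_le_map hy hx e.symm (e s))
    (interval_fst_le_map hx hy e s)

/-- A point starting where s ends is not above s; its image keeps its left endpoint and is not above
the image of s. -/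
theorem interval_snd_le_map (hx : Rep (intervals x) m p) (hy : Rep (intervals y) m' p')
    (e : IntervalOrder x ≃o IntervalOrder y) (s : IntervalOrder x) :
    s.interval.2 ≤ (e s).interval.2 := by
  obtain ⟨b, hb⟩ := hx.left s.interval.2 (hx.le_max _ s.interval_mem)
  obtain ⟨t, ht⟩ := IntervalOrder.exists_interval_eq hb
  have h1 : ¬ s < t := by simp [IntervalOrder.lt_iff, ht]
  rw [← e.lt_iff_lt, IntervalOrder.lt_iff, interval_fst_map hx hy, ht] at h1
  exact not_lt.1 h1

theorem interval_map (hx : Rep (intervals x) m p) (hy : Rep (intervals y) m' p')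
    (e : IntervalOrder x ≃o IntervalOrder y) (s : IntervalOrder x) :
    (e s).interval = s.interval :=
  Prod.ext (interval_fst_map hx hy e s)
    (le_antisymm (by simpa using interval_snd_le_map hy hx e.symm (e s))
      (interval_snd_le_map hx hy e s))

theorem intervals_perm_of_orderIso (hx : Rep (intervals x) m p) (hy : Rep (intervals y) m' p')
    (e : IntervalOrder x ≃o IntervalOrder y) : (intervals x).Perm (intervals y) := by
  let f : Fin (intervals x).length ≃ Fin (intervals y).length := e.toEquiv
  have hf : ∀ k, (intervals y).get (f k) = (intervals x).get k := interval_map hx hy e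
  have h1 : ((List.finRange _).map f).Perm (List.finRange _) := by
    rw [List.perm_ext_iff_of_nodup ((List.nodup_finRange _).map f.injective)
      (List.nodup_finRange _)]
    intro a
    simp only [List.mem_map, List.mem_finRange, true_and, iff_true]
    exact f.surjective a
  have h2 := h1.map (intervals y).get
  rw [List.map_map, List.map_get_finRange] at h2
  rw [← List.map_get_finRange (intervals x)]
  convert h2 using 1
  exact List.map_congr_left fun k _ => (hf k).symm

end Canonical

/-! ### Ascent sequences and their representations -/

theorem intervals_append_singleton (x : List ℕ) (i : ℕ) :
    intervals (x ++ [i]) = step (intervals x) i := by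
  simp [intervals]

theorem length_step (L : List (ℕ × ℕ)) (i : ℕ) : (step L i).length = L.length + 1 := by
  unfold step
  split_ifs <;> simp

theorem length_intervals (x : List ℕ) : (intervals x).length = x.length := by
  induction x using List.reverseRecOn with
  | nil => rfl
  | append_singleton x i ih => simp [intervals_append_singleton, length_step, ih]

theorem asc_append (u : List ℕ) (a i : ℕ) :
    asc (u ++ [a] ++ [i]) = asc (u ++ [a]) + if a < i then 1 else 0 := by
  induction u with
  | nil => simp [asc]
  | cons b u ih =>
    rcases u with _ | ⟨c, u⟩
    · simp [asc]
    · simp only [List.cons_append, asc] at ih ⊢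
      omega

theorem IsAscentSequence.ne_nil {x : List ℕ} (h : IsAscentSequence x) : x ≠ [] := by
  rintro rfl
  simp [IsAscentSequence] at h

theorem isAscentSequence_zero : IsAscentSequence [0] := by
  refine ⟨rfl, fun i hi h => ?_⟩
  simp only [List.length_singleton] at hi
  omega

theorem isAscentSequence_append_singleton {x : List ℕ} (hx : x ≠ []) (i : ℕ) :
    IsAscentSequence (x ++ [i]) ↔ IsAscentSequence x ∧ i ≤ asc x + 1 := by
  have h0 : 0 < x.length := List.length_pos_of_ne_nil hx
  unfold IsAscentSequence
  rw [List.head?_append_of_ne_nil _ hx, and_assoc]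
  refine and_congr_right fun _ => ?_
  constructor
  · intro H
    refine ⟨fun k hk h1 => ?_, ?_⟩
    · have := H k (by simp; omega) h1
      rwa [List.getElem_append_left hk, List.take_append_of_le_length hk.le] at this
    · have := H x.length (by simp) h0
      simp at this
      omega
  · rintro ⟨H, hi⟩ k hk h1
    rw [List.length_append, List.length_singleton] at hk
    rcases Nat.lt_succ_iff_lt_or_eq.1 hk with hk | rfl
    · rw [List.getElem_append_left hk, List.take_append_of_le_length hk.le]
      exact H k hk h1
    · simp
      omega

theorem isAscentSequence_singleton {i : ℕ} : IsAscentSequence [i] ↔ i = 0 := by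
  constructor
  · intro h
    simpa using h.1
  · rintro rfl
    exact isAscentSequence_zero

/-- The intervals of an ascent sequence form a minimal representation; its largest endpoint is the
number of ascents, and its other parameter is the last entry. -/
theorem IsAscentSequence.rep {u : List ℕ} {a : ℕ} (h : IsAscentSequence (u ++ [a])) :
    Rep (intervals (u ++ [a])) (asc (u ++ [a])) a := by
  induction u using List.reverseRecOn generalizing a with
  | nil =>
    obtain rfl := isAscentSequence_singleton.1 h
    exact rep_zero
  | append_singleton u b ih =>
    obtain ⟨h1, h2⟩ := (isAscentSequence_append_singleton (by simp) a).1 h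
    rw [asc_append, intervals_append_singleton]
    exact (ih h1).step h2

theorem IsAscentSequence.exists_rep {x : List ℕ} (h : IsAscentSequence x) :
    ∃ p, Rep (intervals x) (asc x) p := by
  rcases List.eq_nil_or_concat' x with rfl | ⟨u, a, rfl⟩
  · exact (h.ne_nil rfl).elim
  · exact ⟨a, h.rep⟩

/-- An ascent sequence is determined by the multiset of its intervals. -/
theorem IsAscentSequence.eq_of_perm {x y : List ℕ} (hx : IsAscentSequence x)
    (hy : IsAscentSequence y) (e : (intervals x).Perm (intervals y)) : x = y := by
  have hl := e.length_eq
  rw [length_intervals, length_intervals] at hl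
  induction x using List.reverseRecOn generalizing y with
  | nil => exact (hx.ne_nil rfl).elim
  | append_singleton u a ih =>
    rcases List.eq_nil_or_concat' y with rfl | ⟨v, b, rfl⟩
    · exact (hy.ne_nil rfl).elim
    · simp only [List.length_append, List.length_singleton, add_left_inj] at hl
      rcases eq_or_ne u [] with rfl | hu
      · obtain rfl := List.length_eq_zero_iff.1 hl.symm
        rw [List.nil_append] at hx hy
        rw [isAscentSequence_singleton.1 hx, isAscentSequence_singleton.1 hy]
      · have hv : v ≠ [] := by
          rintro rfl
          exact hu (List.length_eq_zero_iff.1 hl)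
        obtain ⟨hu1, hu2⟩ := (isAscentSequence_append_singleton hu a).1 hx
        obtain ⟨hv1, hv2⟩ := (isAscentSequence_append_singleton hv b).1 hy
        obtain ⟨_, hp⟩ := hu1.exists_rep
        obtain ⟨_, hq⟩ := hv1.exists_rep
        rw [intervals_append_singleton, intervals_append_singleton] at e
        obtain ⟨rfl, e'⟩ := step_perm_injective hp hq hu2 hv2 e
        rw [ih hu1 hv1 e' hl]

theorem IsAscentSequence.eq_of_orderIso {x y : List ℕ} (hx : IsAscentSequence x)
    (hy : IsAscentSequence y) (e : IntervalOrder x ≃o IntervalOrder y) : x = y := by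
  obtain ⟨_, hp⟩ := hx.exists_rep
  obtain ⟨_, hq⟩ := hy.exists_rep
  exact hx.eq_of_perm hy (intervals_perm_of_orderIso hp hq e)

/-! ### Steps that preserve properness -/

section ProperSteps

variable {L : List (ℕ × ℕ)} {m p i : ℕ}

theorem Proper.snd_le (hL : Proper L) {a b c d : ℕ} (h : (a, b) ∈ L) (h' : (c, d) ∈ L)
    (hac : a < c) : b ≤ d := hL _ h _ h' hac

theorem Rep.fst_le_of_lt (h : Rep L m p) (hL : Proper L) {a b : ℕ} (hab : (a, b) ∈ L)
    (hb : b < m) : a ≤ p := by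
  by_contra! hlt
  exact absurd (hL.snd_le h.mem hab hlt) (not_le.2 hb)

theorem Rep.mem_of_le (h : Rep L m p) (hL : Proper L) {k : ℕ} (hk : p ≤ k) (hkm : k ≤ m) :
    (k, m) ∈ L := by
  obtain ⟨b, hb⟩ := h.left k hkm
  have h1 : b ≤ m := h.le_max _ hb
  rcases eq_or_lt_of_le h1 with rfl | h2
  · exact hb
  · obtain rfl := le_antisymm hk (h.fst_le_of_lt hL hb h2)
    exact h.mem

theorem Rep.exists_pred (h : Rep L m p) (hp : 1 ≤ p) : ∃ b, (p - 1, b) ∈ L ∧ b < m := by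
  have hpm : p ≤ m := h.valid _ h.mem
  obtain ⟨b, hb⟩ := h.left (p - 1) (by omega)
  have h1 : b ≤ m := h.le_max _ hb
  refine ⟨b, hb, lt_of_le_of_ne h1 ?_⟩
  rintro rfl
  have := h.min _ hb
  omega

/-- The new interval reaches the maximum, so it cannot lie in the interior of another; it can only
contain one that starts after i and ends before m. -/
theorem Rep.proper_low_iff (h : Rep L m p) (hL : Proper L) (hi : i ≤ p) :
    Proper (SemiorderGF.step L i) ↔ ∀ a b, (a, b) ∈ L → b < m → a ≤ i := by
  rw [h.step_low hi]
  constructor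
  · intro H a b hab hb
    by_contra! hlt
    exact absurd (H (i, m) (by simp) (a, b) (by simp [hab]) hlt) (not_le.2 hb)
  · rintro H I hI ⟨c, d⟩ hJ hIJ
    rcases List.mem_cons.1 hI with rfl | hI <;> rcases List.mem_cons.1 hJ with hJ | hJ
    · rw [Prod.mk.injEq] at hJ
      exact hJ.2.ge
    · by_contra! hlt
      exact absurd (H _ _ hJ hlt) (not_le.2 hIJ)
    · rw [Prod.mk.injEq] at hJ
      exact (h.le_max _ hI).trans hJ.2.ge
    · exact hL _ hI _ hJ hIJ

theorem Rep.proper_top (h : Rep L m p) (hL : Proper L) :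
    Proper (SemiorderGF.step L (m + 1)) := by
  rw [h.step_top]
  rintro I hI J hJ hIJ
  rcases List.mem_cons.1 hI with rfl | hI <;> rcases List.mem_cons.1 hJ with rfl | hJ
  · exact le_rfl
  · have := h.fst_le hJ
    simp only at hIJ
    omega
  · exact (h.le_max _ hI).trans (Nat.le_succ m)
  · exact hL _ hI _ hJ hIJ

/-- By properness [i - 1, m] is present and is truncated to [i - 1, i]. An interval with a < i - 1
and i ≤ b < m is stretched and then has it in its interior; this is the only obstruction. -/
theorem Rep.proper_mid_iff (h : Rep L m p) (hL : Proper L) (hi : p < i) (hm : i ≤ m) :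
    Proper (SemiorderGF.step L i) ↔ ∀ a b, (a, b) ∈ L → i ≤ b → b < m → i ≤ a + 1 := by
  constructor
  · intro H a b hab hib hb
    by_contra! hlt
    have h1 : (i - 1, i) ∈ SemiorderGF.step L i := (h.mem_step_mid hi hm).2
      (Or.inr (Or.inr (Or.inl ⟨h.mem_of_le hL (by omega) (by omega), by omega, rfl⟩)))
    have h2 : (a, b + 1) ∈ SemiorderGF.step L i := (h.mem_step_mid hi hm).2
      (Or.inr (Or.inr (Or.inr (Or.inl ⟨b, hab, by omega, hib, hb, rfl⟩))))
    have := H.snd_le h2 h1 (by omega)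
    omega
  · rintro H ⟨a, b⟩ hI ⟨c, d⟩ hJ hIJ
    rw [h.mem_step_mid hi hm] at hI hJ
    simp only at hIJ ⊢
    have hc : ∀ c d, (c, d) ∈ L → d < m → c ≤ p := fun c d => h.fst_le_of_lt hL
    rcases hJ with ⟨h1, h2⟩ | ⟨c', d', h1, h2, h3, h4⟩ | ⟨h1, h2, h3⟩ | ⟨d', h1, h2, h3, h4, h5⟩ |
      ⟨h1, h2⟩ <;>
    rcases hI with ⟨g1, g2⟩ | ⟨a', b', g1, g2, g3, g4⟩ | ⟨g1, g2, g3⟩ | ⟨b', g1, g2, g3, g4, g5⟩ |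
      ⟨g1, g2⟩
    -- There are 25 pairs of origins; `try` passes over the new interval, which comes from no member
    -- of L.
    all_goals try have v1 := h.valid _ g1
    all_goals try have v2 := h.le_max _ g1
    all_goals try have w1 := h.valid _ h1
    all_goals try have w2 := h.le_max _ h1
    all_goals try have w3 := hc _ _ h1
    all_goals try have v3 := hc _ _ g1
    all_goals try have w4 := H _ _ h1
    all_goals try have v4 := H _ _ g1
    all_goals try have pr := hL _ g1 _ h1
    all_goals try simp only at v1 v2
    all_goals try simp only at w1 w2
    all_goals try simp only at pr
    all_goals omega

end ProperSteps

/-! ### The eight types and their transitions -/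

/-- The types of proper representations, with largest endpoint `m` and smallest left endpoint `p`
matching it, which behave alike under the construction. -/
inductive Kind
  | start | tight₀ | tight₁ | tight₂ | loose | wide | low₁ | low₂

/-- The new entries that keep a representation proper, with the types of the results. -/
def moves (m p : ℕ) : Kind → List (ℕ × Kind)
  | .start => [(p, .start), (m + 1, .tight₀)]
  | .tight₀ => [(p, .tight₀), (p - 1, .low₁), (m + 1, .tight₀)]
  | .tight₁ => [(p, .tight₁), (p - 1, .low₂), (m, .tight₁), (m + 1, .tight₀)]
  | .tight₂ => [(p, .tight₂), (p - 1, .low₂), (m, .loose), (m + 1, .tight₀)]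
  | .loose => [(p, .loose), (p - 1, .wide), (m, .tight₁), (m + 1, .tight₀)]
  | .wide => [(p, .wide), (m, .loose), (m + 1, .tight₀)]
  | .low₁ => [(p, .low₁), (m, .tight₁), (m + 1, .tight₀)]
  | .low₂ => [(p, .low₂), (p + 1, .tight₂), (m, .loose), (m + 1, .tight₀)]

/-- The representations of each type. -/
def Shape (L : List (ℕ × ℕ)) (m p : ℕ) : Kind → Prop
  | .start => m = 0 ∧ p = 0
  | .tight₀ => 1 ≤ p ∧ m = p ∧ ∀ a b, (a, b) ∈ L → b < m → a < p
  | .tight₁ => 1 ≤ p ∧ m = p + 1 ∧ (∀ a b, (a, b) ∈ L → b < m → a < p) ∧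
      ∀ a b, (a, b) ∈ L → p ≤ b → b < m → a + 1 = p
  | .tight₂ => 1 ≤ p ∧ p + 2 ≤ m ∧ (∀ a b, (a, b) ∈ L → b < m → a < p) ∧
      ∀ a b, (a, b) ∈ L → p ≤ b → b < m → a + 1 = p
  | .loose => 1 ≤ p ∧ m = p + 1 ∧ (∀ a b, (a, b) ∈ L → b < m → a < p) ∧
      ∃ a b, (a, b) ∈ L ∧ p ≤ b ∧ b < m ∧ a + 1 < p
  | .wide => m = p + 2 ∧ (∃ b, (p, b) ∈ L ∧ b < m) ∧
      ∃ a b, (a, b) ∈ L ∧ p < b ∧ b < m ∧ a < p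
  | .low₁ => m = p + 1 ∧ ∃ b, (p, b) ∈ L ∧ b < m
  | .low₂ => p + 2 ≤ m ∧ (∃ b, (p, b) ∈ L ∧ b < m) ∧
      ∀ a b, (a, b) ∈ L → p < b → b < m → a = p

/-- Proper representations of type `k`. -/
structure Good (L : List (ℕ × ℕ)) (m p : ℕ) (k : Kind) : Prop where
  rep : Rep L m p
  proper : Proper L
  shape : Shape L m p k

section Transitions

variable {L : List (ℕ × ℕ)} {m p i : ℕ} {k k' : Kind}

theorem good_zero : Good [(0, 0)] 0 0 .start :=
  ⟨rep_zero, by simp [Proper], rfl, rfl⟩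

theorem Good.le (h : Good L m p k) : p ≤ m := h.rep.valid _ h.rep.mem

theorem Shape.congr {L' : List (ℕ × ℕ)} (h : ∀ I, I ∈ L' ↔ I ∈ L) :
    Shape L' m p k ↔ Shape L m p k := by
  cases k <;> simp only [Shape, h]

theorem Good.stay (h : Good L m p k) : Good (step L p) (nextMax m p p) p k := by
  have hmem : ∀ I, I ∈ step L p ↔ I ∈ L := by
    intro I
    rw [h.rep.step_low le_rfl, List.mem_cons, or_iff_right_iff_imp]
    rintro rfl
    exact h.rep.mem
  have hm := h.le
  refine ⟨h.rep.step (by omega), fun I hI J hJ => ?_, ?_⟩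
  · rw [hmem] at hI hJ
    exact h.proper I hI J hJ
  · simpa [nextMax, Shape.congr hmem] using h.shape

theorem Good.top (h : Good L m p k) :
    Good (step L (m + 1)) (nextMax m p (m + 1)) (m + 1) .tight₀ := by
  have hm := h.le
  refine ⟨h.rep.step le_rfl, h.rep.proper_top h.proper, by omega, ?_, fun a b hab hb => ?_⟩
  · simp [nextMax]
    omega
  · rw [h.rep.step_top] at hab
    rcases List.mem_cons.1 hab with h1 | h1
    · rw [Prod.mk.injEq] at h1
      simp only [nextMax, if_pos (show p < m + 1 by omega)] at hb
      omega
    · have := h.rep.fst_le h1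
      simp only at this
      omega

/-- The low step to the left neighbour, common part. -/
theorem Good.pred_aux (h : Good L m p k) (hp : 1 ≤ p)
    (hA : ∀ a b, (a, b) ∈ L → b < m → a < p)
    (hs : ∀ L', (∃ b, (p - 1, b) ∈ L' ∧ b < m) →
      (∀ a b, b < m → ((a, b) ∈ L' ↔ (a, b) ∈ L)) → Shape L' m (p - 1) k') :
    Good (step L (p - 1)) (nextMax m p (p - 1)) (p - 1) k' := by
  have hm := h.le
  refine ⟨h.rep.step (by omega), (h.rep.proper_low_iff h.proper (by omega)).2
    fun a b hab hb => ?_, ?_⟩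
  · have := hA a b hab hb
    omega
  · have hn : nextMax m p (p - 1) = m := by simp [nextMax]
    rw [hn, h.rep.step_low (Nat.sub_le p 1)]
    obtain ⟨b, hb, hbm⟩ := h.rep.exists_pred hp
    refine hs _ ⟨b, by simp [hb], hbm⟩ fun a b hb => ?_
    rw [List.mem_cons, or_iff_right_iff_imp, Prod.mk.injEq]
    rintro ⟨_, rfl⟩
    exact (lt_irrefl _ hb).elim

/-- For i = m the obstruction would need m ≤ b < m, so this step is always allowed. -/
theorem Good.mid_max (h : Good L m p k) (hp : p < m) :
    Rep (step L m) (m + 1) m ∧ Proper (step L m) ∧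
      ∀ a b, (a, b) ∈ step L m → b < m + 1 → a < m := by
  refine ⟨h.rep.mid hp le_rfl, (h.rep.proper_mid_iff h.proper hp le_rfl).2
    fun a b _ h1 h2 => by omega, fun a b hab hb => ?_⟩
  rw [h.rep.mem_step_mid hp le_rfl] at hab
  rcases hab with ⟨h1, h2⟩ | ⟨a', b', h1, h2, h3, h4⟩ | ⟨h1, h2, h3⟩ | ⟨b', h1, h2, h3, h4, h5⟩ |
    ⟨h1, h2⟩
  · omega
  · have := h.rep.valid _ h1
    simp only at this
    omega
  · omega
  · omega
  · have := h.rep.valid _ h1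
    simp only at this
    omega

/-- The intervals that now end just below the new maximum are the truncated ones. They start in [p,
m - 1], which is a single point when the gap is one. -/
theorem Good.max_tight (h : Good L m p k) (hp : m = p + 1) :
    Good (step L m) (nextMax m p m) m .tight₁ := by
  have hpm : p < m := by omega
  obtain ⟨h1, h2, h3⟩ := h.mid_max hpm
  have hn : nextMax m p m = m + 1 := by simp [nextMax, hpm]
  rw [hn]
  refine ⟨h1, h2, by omega, rfl, h3, fun a b hab hb hb' => ?_⟩
  obtain rfl : b = m := by omega
  have := h3 a b hab hb'
  rw [h.rep.mem_step_mid hpm le_rfl] at hab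
  rcases hab with ⟨h1, h2⟩ | ⟨a', b', h1, h2, h3, h4⟩ | ⟨h1, h2, h3⟩ | ⟨b', h1, h2, h3, h4, h5⟩ |
    ⟨h1, h2⟩
  · omega
  · omega
  · have := h.rep.min _ h1
    omega
  · omega
  · omega

/-- The truncated interval [p, m] starts at least two before the new parameter m, and is the witness
for the loose type. -/
theorem Good.max_loose (h : Good L m p k) (hp : p + 2 ≤ m) :
    Good (step L m) (nextMax m p m) m .loose := by
  have hpm : p < m := by omega
  obtain ⟨h1, h2, h3⟩ := h.mid_max hpm
  have hn : nextMax m p m = m + 1 := by simp [nextMax, hpm]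
  rw [hn]
  refine ⟨h1, h2, by omega, rfl, h3, p, m, ?_, le_rfl, by omega, by omega⟩
  simp [h.rep.mem_step_mid hpm le_rfl, h.rep.mem, hpm]

/-- Intervals ending strictly between p and m start at p, which both removes the obstruction to p +
1 and, after stretching, gives the condition of the new type. -/
theorem Good.succ_tight (h : Good L m p .low₂) :
    Good (step L (p + 1)) (nextMax m p (p + 1)) (p + 1) .tight₂ := by
  obtain ⟨hp, -, hC⟩ := h.shape
  have hpm : p + 1 ≤ m := by omega
  have hn : nextMax m p (p + 1) = m + 1 := by simp [nextMax]
  rw [hn]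
  have hc : ∀ c d, (c, d) ∈ L → d < m → c ≤ p := fun c d => h.rep.fst_le_of_lt h.proper
  refine ⟨h.rep.mid (Nat.lt_succ_self p) hpm,
    (h.rep.proper_mid_iff h.proper (Nat.lt_succ_self p) hpm).2 fun a b h1 h2 h3 => ?_,
    by omega, by omega, fun a b hab hb => ?_, fun a b hab hb hb' => ?_⟩
  · rw [hC a b h1 h2 h3]
  all_goals
    rw [h.rep.mem_step_mid (Nat.lt_succ_self p) hpm] at hab
    rcases hab with ⟨h1, h2⟩ | ⟨a', b', h1, h2, h3, h4⟩ | ⟨h1, h2, h3⟩ |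
      ⟨b', h1, h2, h3, h4, h5⟩ | ⟨h1, h2⟩
  · omega
  · have := hc _ _ h1
    omega
  · omega
  · omega
  · have := hc _ _ h1
    omega
  · omega
  · have := hc _ _ h1
    omega
  · have := h.rep.min _ h1
    omega
  · rw [hC a b' h1 h3 h4]
  · omega

theorem Good.step_of_mem (h : Good L m p k) (hi : (i, k') ∈ moves m p k) :
    i ≤ m + 1 ∧ Good (step L i) (nextMax m p i) i k' := by
  have hm := h.le
  have hs := h.shape
  cases k <;> simp only [moves, List.mem_cons, Prod.mk.injEq, List.not_mem_nil, or_false] at hi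
  · rcases hi with ⟨rfl, rfl⟩ | ⟨rfl, rfl⟩
    · exact ⟨by omega, h.stay⟩
    · exact ⟨le_rfl, h.top⟩
  · obtain ⟨h1, h2, h3⟩ := hs
    rcases hi with ⟨rfl, rfl⟩ | ⟨rfl, rfl⟩ | ⟨rfl, rfl⟩
    · exact ⟨by omega, h.stay⟩
    · exact ⟨by omega, h.pred_aux h1 h3 fun L' h4 h5 => ⟨by omega, h4⟩⟩
    · exact ⟨le_rfl, h.top⟩
  · obtain ⟨h1, h2, h3, h6⟩ := hs
    rcases hi with ⟨rfl, rfl⟩ | ⟨rfl, rfl⟩ | ⟨rfl, rfl⟩ | ⟨rfl, rfl⟩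
    · exact ⟨by omega, h.stay⟩
    · refine ⟨by omega, h.pred_aux h1 h3 fun L' h4 h5 => ⟨by omega, h4, fun a b hab hb hb' => ?_⟩⟩
      have := h6 a b ((h5 a b hb').1 hab) (by omega) hb'
      omega
    · exact ⟨by omega, h.max_tight h2⟩
    · exact ⟨le_rfl, h.top⟩
  · obtain ⟨h1, h2, h3, h6⟩ := hs
    rcases hi with ⟨rfl, rfl⟩ | ⟨rfl, rfl⟩ | ⟨rfl, rfl⟩ | ⟨rfl, rfl⟩
    · exact ⟨by omega, h.stay⟩
    · refine ⟨by omega, h.pred_aux h1 h3 fun L' h4 h5 => ⟨by omega, h4, fun a b hab hb hb' => ?_⟩⟩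
      have := h6 a b ((h5 a b hb').1 hab) (by omega) hb'
      omega
    · exact ⟨by omega, h.max_loose h2⟩
    · exact ⟨le_rfl, h.top⟩
  · obtain ⟨h1, h2, h3, a, b, h6, h7, h8, h9⟩ := hs
    rcases hi with ⟨rfl, rfl⟩ | ⟨rfl, rfl⟩ | ⟨rfl, rfl⟩ | ⟨rfl, rfl⟩
    · exact ⟨by omega, h.stay⟩
    · exact ⟨by omega, h.pred_aux h1 h3 fun L' h4 h5 =>
        ⟨by omega, h4, a, b, (h5 a b h8).2 h6, by omega, h8, by omega⟩⟩
    · exact ⟨by omega, h.max_tight h2⟩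
    · exact ⟨le_rfl, h.top⟩
  · obtain ⟨h1, -⟩ := hs
    rcases hi with ⟨rfl, rfl⟩ | ⟨rfl, rfl⟩ | ⟨rfl, rfl⟩
    · exact ⟨by omega, h.stay⟩
    · exact ⟨by omega, h.max_loose h1.ge⟩
    · exact ⟨le_rfl, h.top⟩
  · obtain ⟨h1, -⟩ := hs
    rcases hi with ⟨rfl, rfl⟩ | ⟨rfl, rfl⟩ | ⟨rfl, rfl⟩
    · exact ⟨by omega, h.stay⟩
    · exact ⟨by omega, h.max_tight h1⟩
    · exact ⟨le_rfl, h.top⟩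
  · obtain ⟨h1, -⟩ := hs
    rcases hi with ⟨rfl, rfl⟩ | ⟨rfl, rfl⟩ | ⟨rfl, rfl⟩ | ⟨rfl, rfl⟩
    · exact ⟨by omega, h.stay⟩
    · exact ⟨by omega, h.succ_tight⟩
    · exact ⟨by omega, h.max_loose h1⟩
    · exact ⟨le_rfl, h.top⟩

/-- An entry strictly between p and m is the right endpoint of some [a, i]; properness gives a ≤ p
and the criterion for middle steps gives i ≤ a + 1, so i = p + 1 and a = p. An entry below p is at
least p - 1, because some interval starting at p - 1 ends before m. The type decides among the
remaining candidates. -/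
theorem Good.exists_move (h : Good L m p k) (hi : i ≤ m + 1) (hP : Proper (step L i)) :
    ∃ k', (i, k') ∈ moves m p k := by
  have hm := h.le
  have hs := h.shape
  have hmid : p < i → i < m → ∃ a, (a, i) ∈ L ∧ i = p + 1 ∧ a = p := by
    intro h1 h2
    obtain ⟨a, ha⟩ := h.rep.right i h2.le
    have h3 := (h.rep.proper_mid_iff h.proper h1 h2.le).1 hP a i ha le_rfl h2
    have h4 := h.rep.fst_le_of_lt h.proper ha h2
    exact ⟨a, ha, by omega, by omega⟩
  have hpred : 1 ≤ p → i ≤ p → i = p ∨ i = p - 1 := by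
    intro h1 h2
    obtain ⟨b, hb, hb'⟩ := h.rep.exists_pred h1
    have := (h.rep.proper_low_iff h.proper h2).1 hP _ b hb hb'
    omega
  have hlow : (∃ b, (p, b) ∈ L ∧ b < m) → i ≤ p → i = p := by
    rintro ⟨b, hb, hb'⟩ h2
    exact le_antisymm h2 ((h.rep.proper_low_iff h.proper h2).1 hP _ b hb hb')
  have htight : (∀ a b, (a, b) ∈ L → b < m → a < p) → p < i → m ≤ i := by
    intro h1 h2
    by_contra! h3
    obtain ⟨a, ha, -, rfl⟩ := hmid h2 h3
    exact lt_irrefl _ (h1 _ _ ha h3)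
  suffices ∃ k', (i = p ∧ (p, k') ∈ moves m p k) ∨ (i = p - 1 ∧ (p - 1, k') ∈ moves m p k) ∨
      (i = p + 1 ∧ (p + 1, k') ∈ moves m p k) ∨
      (i = m ∧ (m, k') ∈ moves m p k) ∨ (i = m + 1 ∧ (m + 1, k') ∈ moves m p k) by
    obtain ⟨k', ⟨rfl, h'⟩ | ⟨rfl, h'⟩ | ⟨rfl, h'⟩ | ⟨rfl, h'⟩ | ⟨rfl, h'⟩⟩ := this <;>
      exact ⟨k', h'⟩
  have htop : (m + 1, Kind.tight₀) ∈ moves m p k := by cases k <;> simp [moves]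
  have hstay : (p, k) ∈ moves m p k := by cases k <;> simp [moves]
  by_cases e1 : i = m + 1
  · exact ⟨_, Or.inr (Or.inr (Or.inr (Or.inr ⟨e1, htop⟩)))⟩
  by_cases e2 : i = p
  · exact ⟨_, Or.inl ⟨e2, hstay⟩⟩
  cases k
  · obtain ⟨h1, h2⟩ := hs
    omega
  · obtain ⟨h1, h2, h3⟩ := hs
    exact ⟨.low₁, Or.inr (Or.inl ⟨by omega, by simp [moves]⟩)⟩
  · obtain ⟨h1, h2, h3, -⟩ := hs
    have := htight h3
    rcases le_or_gt i p with h4 | h4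
    · exact ⟨.low₂, Or.inr (Or.inl ⟨by omega, by simp [moves]⟩)⟩
    · exact ⟨.tight₁, Or.inr (Or.inr (Or.inr (Or.inl ⟨by omega, by simp [moves]⟩)))⟩
  · obtain ⟨h1, h2, h3, -⟩ := hs
    have := htight h3
    rcases le_or_gt i p with h4 | h4
    · exact ⟨.low₂, Or.inr (Or.inl ⟨by omega, by simp [moves]⟩)⟩
    · exact ⟨.loose, Or.inr (Or.inr (Or.inr (Or.inl ⟨by omega, by simp [moves]⟩)))⟩
  · obtain ⟨h1, h2, h3, -⟩ := hs
    have := htight h3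
    rcases le_or_gt i p with h4 | h4
    · exact ⟨.wide, Or.inr (Or.inl ⟨by omega, by simp [moves]⟩)⟩
    · exact ⟨.tight₁, Or.inr (Or.inr (Or.inr (Or.inl ⟨by omega, by simp [moves]⟩)))⟩
  · obtain ⟨h1, h2, a, b, h3, h4, h5, h6⟩ := hs
    have h7 := hlow h2
    have h8 : i ≠ p + 1 := by
      rintro rfl
      have := (h.rep.proper_mid_iff h.proper (Nat.lt_succ_self p) (by omega)).1 hP a b h3 h4 h5
      omega
    exact ⟨.loose, Or.inr (Or.inr (Or.inr (Or.inl ⟨by omega, by simp [moves]⟩)))⟩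
  · obtain ⟨h1, h2⟩ := hs
    have h7 := hlow h2
    exact ⟨.tight₁, Or.inr (Or.inr (Or.inr (Or.inl ⟨by omega, by simp [moves]⟩)))⟩
  · obtain ⟨h1, h2, -⟩ := hs
    have h7 := hlow h2
    by_cases e3 : i = p + 1
    · exact ⟨.tight₂, Or.inr (Or.inr (Or.inl ⟨e3, by simp [moves]⟩))⟩
    · have : ¬ (p < i ∧ i < m) := by
        rintro ⟨h4, h5⟩
        obtain ⟨_, -, h6, -⟩ := hmid h4 h5
        exact e3 h6
      exact ⟨.loose, Or.inr (Or.inr (Or.inr (Or.inl ⟨by omega, by simp [moves]⟩)))⟩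

/-- The shapes keep the listed entries apart: p ≥ 1 separates p - 1 from p under truncated
subtraction, and p + 2 ≤ m separates p + 1 from m for `low₂`. -/
theorem Good.nodup_moves (h : Good L m p k) : ((moves m p k).map Prod.fst).Nodup := by
  have hs := h.shape
  cases k <;> simp only [Shape] at hs <;> simp [moves] <;> omega

end Transitions

/-! ### Counting hereditary sequences as words of moves -/

/-- `w` extends a proper representation `L` through proper representations only. -/
def ProperExt : List (ℕ × ℕ) → ℕ → ℕ → List ℕ → Prop
  | _, _, _, [] => True
  | L, m, p, i :: w => i ≤ m + 1 ∧ Proper (step L i) ∧ ProperExt (step L i) (nextMax m p i) i w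

/-- The words of length `n` consisting of successive moves. -/
def words : ℕ → ℕ → ℕ → Kind → List (List ℕ)
  | 0, _, _, _ => [[]]
  | n + 1, m, p, k =>
    (moves m p k).flatMap fun s => (words n (nextMax m p s.1) s.1 s.2).map (List.cons s.1)

/-- The number of words of length `n` starting from a representation of type `k`. -/
def numWords : ℕ → Kind → ℕ
  | 0, _ => 1
  -- The types of the successors do not depend on m and p, so the zeros are placeholders.
  | n + 1, k => ((moves 0 0 k).map fun s => numWords n s.2).sum

theorem length_words (n m p : ℕ) (k : Kind) : (words n m p k).length = numWords n k := by
  induction n generalizing m p k with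
  | zero => rfl
  | succ n ih => cases k <;> simp [words, numWords, moves, ih]

theorem mem_words {L : List (ℕ × ℕ)} {m p : ℕ} {k : Kind} (h : Good L m p k) {n : ℕ}
    {w : List ℕ} : w ∈ words n m p k ↔ w.length = n ∧ ProperExt L m p w := by
  induction n generalizing L m p k w with
  | zero =>
    simp only [words, List.mem_singleton, List.length_eq_zero_iff]
    constructor
    · rintro rfl
      exact ⟨rfl, trivial⟩
    · exact And.left
  | succ n ih =>
    simp only [words, List.mem_flatMap, List.mem_map]
    constructor
    · rintro ⟨⟨i, k'⟩, hs, v, hv, rfl⟩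
      obtain ⟨hi, hg⟩ := h.step_of_mem hs
      obtain ⟨h1, h2⟩ := (ih hg).1 hv
      exact ⟨by simp [h1], hi, hg.proper, h2⟩
    · rintro ⟨hl, hw⟩
      rcases w with _ | ⟨i, v⟩
      · simp at hl
      · obtain ⟨hi, hP, hv⟩ := hw
        obtain ⟨k', hk'⟩ := h.exists_move hi hP
        exact ⟨(i, k'), hk', v, (ih (h.step_of_mem hk').2).2 ⟨by simpa using hl, hv⟩, rfl⟩

theorem nodup_words {L : List (ℕ × ℕ)} {m p : ℕ} {k : Kind} (h : Good L m p k) (n : ℕ) :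
    (words n m p k).Nodup := by
  induction n generalizing L m p k with
  | zero => simp [words]
  | succ n ih =>
    rw [words, List.nodup_flatMap]
    refine ⟨fun s hs => (ih (h.step_of_mem hs).2).map List.cons_injective, ?_⟩
    refine (List.pairwise_map.1 h.nodup_moves).imp ?_
    intro s t hst
    rw [Function.onFun, List.disjoint_left]
    intro w hs ht
    obtain ⟨_, -, rfl⟩ := List.mem_map.1 hs
    obtain ⟨_, -, he⟩ := List.mem_map.1 ht
    exact hst (List.cons.inj he).1.symm

/-- Ascent sequences all of whose nonempty initial segments correspond to semiorders. -/
def IsHereditarySeq (x : List ℕ) : Prop :=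
  IsAscentSequence x ∧ ∀ i, 1 ≤ i → i ≤ x.length → IsSemiorder (IntervalOrder (x.take i))

theorem isHereditarySeq_append_singleton {u : List ℕ} {a : ℕ} (i : ℕ)
    (hu : IsHereditarySeq (u ++ [a])) :
    IsHereditarySeq (u ++ [a] ++ [i]) ↔
      i ≤ asc (u ++ [a]) + 1 ∧ Proper (step (intervals (u ++ [a])) i) := by
  have hne : u ++ [a] ≠ [] := by simp
  generalize hx : u ++ [a] = x at *
  have key : IsAscentSequence (x ++ [i]) →
      (IsSemiorder (IntervalOrder (x ++ [i])) ↔ Proper (step (intervals x) i)) := fun h => by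
    rw [isSemiorder_iff_proper h.rep, intervals_append_singleton]
  constructor
  · intro h
    refine ⟨((isAscentSequence_append_singleton hne i).1 h.1).2, (key h.1).1 ?_⟩
    have := h.2 (x ++ [i]).length (by simp) le_rfl
    rwa [List.take_length] at this
  · rintro ⟨h1, h2⟩
    have ha := (isAscentSequence_append_singleton hne i).2 ⟨hu.1, h1⟩
    refine ⟨ha, fun j hj hj' => ?_⟩
    rw [List.length_append, List.length_singleton] at hj'
    rcases Nat.lt_succ_iff_lt_or_eq.1 (Nat.lt_succ_of_le hj') with h | rfl
    · rw [List.take_append_of_le_length (by omega)]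
      exact hu.2 j hj (by omega)
    · rw [List.take_of_length_le (by simp)]
      exact (key ha).2 h2

theorem IsAscentSequence.of_append {x w : List ℕ} (hx : x ≠ []) (h : IsAscentSequence (x ++ w)) :
    IsAscentSequence x := by
  induction w using List.reverseRecOn with
  | nil => simpa using h
  | append_singleton w i ih =>
    rw [← List.append_assoc] at h
    exact ih ((isAscentSequence_append_singleton (by simp [hx]) i).1 h).1

theorem IsHereditarySeq.of_append {x w : List ℕ} (hx : x ≠ []) (h : IsHereditarySeq (x ++ w)) :
    IsHereditarySeq x := by
  refine ⟨h.1.of_append hx, fun i hi hi' => ?_⟩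
  have := h.2 i hi (by simp; omega)
  rwa [List.take_append_of_le_length hi'] at this

theorem isHereditarySeq_append_iff {u : List ℕ} {a : ℕ} (w : List ℕ)
    (hu : IsHereditarySeq (u ++ [a])) :
    IsHereditarySeq (u ++ [a] ++ w) ↔
      ProperExt (intervals (u ++ [a])) (asc (u ++ [a])) a w := by
  induction w generalizing u a with
  | nil => simpa [ProperExt] using hu
  | cons i w ih =>
    rw [List.append_cons]
    have h1 := isHereditarySeq_append_singleton i hu
    have h2 : IsHereditarySeq (u ++ [a] ++ [i]) → _ := fun h => ih h
    rw [intervals_append_singleton (u ++ [a]), asc_append] at h2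
    constructor
    · intro h
      have h3 := h.of_append (by simp)
      exact ⟨(h1.1 h3).1, (h1.1 h3).2, (h2 h3).1 h⟩
    · rintro ⟨h3, h4, h5⟩
      exact (h2 (h1.2 ⟨h3, h4⟩)).2 h5

theorem isHereditarySeq_zero : IsHereditarySeq [0] := by
  refine ⟨isAscentSequence_zero, fun i hi _ => ?_⟩
  rw [List.take_of_length_le (by simpa using hi)]
  exact (isSemiorder_iff_proper (x := [0]) rep_zero).2 good_zero.proper

theorem setOf_isHereditarySeq_eq (n : ℕ) :
    {x | IsHereditarySeq x ∧ x.length = n + 1} =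
      (((words n 0 0 .start).map (List.cons 0)).toFinset : Set (List ℕ)) := by
  ext x
  have key : ∀ w, IsHereditarySeq (0 :: w) ↔ ProperExt [(0, 0)] 0 0 w := fun w =>
    isHereditarySeq_append_iff (u := []) w isHereditarySeq_zero
  simp only [Set.mem_ofPred_eq, List.coe_toFinset, List.mem_map, mem_words good_zero]
  constructor
  · rintro ⟨h, hl⟩
    rcases x with _ | ⟨b, w⟩
    · simp at hl
    · obtain rfl : b = 0 := by simpa using h.1.1
      exact ⟨w, ⟨by simpa using hl, (key w).1 h⟩, rfl⟩
  · rintro ⟨w, ⟨h1, h2⟩, rfl⟩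
    exact ⟨(key w).2 h2, by simp [h1]⟩

theorem ncard_isHereditarySeq (n : ℕ) :
    {x | IsHereditarySeq x ∧ x.length = n + 1}.ncard = numWords n .start := by
  rw [setOf_isHereditarySeq_eq, Set.ncard_coe_finset, List.toFinset_card_of_nodup
    ((nodup_words good_zero n).map List.cons_injective), List.length_map, length_words]

/-! ### From sequences to isomorphism classes -/

section Classes

variable {n : ℕ} {x : List ℕ}

/-- The points of the interval order of a sequence of length `n` are labelled by `Fin n`. -/
def pointEquiv (hx : x.length = n) : Fin n ≃ IntervalOrder x :=
  finCongr ((length_intervals x).trans hx).symm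

/-- The interval order of a sequence of length `n`, as an order on `Fin n`. -/
@[reducible] def orderOnFin (hx : x.length = n) : PartialOrder (Fin n) :=
  PartialOrder.lift (pointEquiv hx) (pointEquiv hx).injective

/-- The identification of `Fin n` with the points of the interval order. -/
def orderOnFinIso (hx : x.length = n) :
    @OrderIso (Fin n) (IntervalOrder x) (orderOnFin hx).toLE _ :=
  @RelIso.mk (Fin n) (IntervalOrder x) (orderOnFin hx).le (· ≤ ·) (pointEquiv hx) Iff.rfl

theorem isHereditary_iff {α : Type*} [PartialOrder α] :
    IsHereditary α ↔ ∃ x, IsHereditarySeq x ∧ Nonempty (α ≃o IntervalOrder x) := by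
  constructor
  · rintro ⟨-, x, h1, h2, h3⟩
    exact ⟨x, ⟨h1, h3⟩, h2⟩
  · rintro ⟨x, ⟨h1, h3⟩, ⟨e⟩⟩
    refine ⟨IsSemiorder.of_orderIso e ?_, x, h1, ⟨e⟩, h3⟩
    have := h3 x.length (List.length_pos_of_ne_nil h1.ne_nil) le_rfl
    rwa [List.take_length] at this

/-- A sequence is sent to the class of its order. Injectivity is `IsAscentSequence.eq_of_orderIso`;
surjectivity holds because the definition of hereditary provides a sequence. -/
theorem numHereditary_eq (n : ℕ) :
    numHereditary n = {x | IsHereditarySeq x ∧ x.length = n}.ncard := by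
  symm
  refine Set.ncard_congr (fun x hx => Quotient.mk (isoSetoid n) (orderOnFin hx.2)) ?_ ?_ ?_
  · intro x hx
    exact ⟨orderOnFin hx.2, (@isHereditary_iff _ (orderOnFin hx.2)).2
      ⟨x, hx.1, ⟨orderOnFinIso hx.2⟩⟩, rfl⟩
  · intro x y hx hy h
    obtain ⟨e⟩ := Quotient.exact h
    have e' : IntervalOrder x ≃o IntervalOrder y :=
      @OrderIso.trans _ _ _ _ (orderOnFin hx.2).toLE _
        (@OrderIso.symm _ _ (orderOnFin hx.2).toLE _ (orderOnFinIso hx.2))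
        (@OrderIso.trans _ _ _ (orderOnFin hx.2).toLE (orderOnFin hy.2).toLE _ e
          (orderOnFinIso hy.2))
    exact hx.1.1.eq_of_orderIso hy.1.1 e'
  · rintro q ⟨P, hP, rfl⟩
    obtain ⟨x, hx, ⟨e⟩⟩ := isHereditary_iff.1 hP
    have hl : x.length = n := by
      have f : Fin n ≃ Fin (intervals x).length := e.toEquiv
      have := Fintype.card_congr f
      rw [Fintype.card_fin, Fintype.card_fin, length_intervals] at this
      exact this.symm
    refine ⟨x, ⟨hx, hl⟩, Quotient.sound ⟨?_⟩⟩
    exact @OrderIso.trans _ _ _ (orderOnFin hl).toLE _ P.toLE (orderOnFinIso hl)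
      (@OrderIso.symm _ _ P.toLE _ e)

end Classes

theorem numHereditary_zero : numHereditary 0 = 0 := by
  rw [numHereditary_eq]
  convert Set.ncard_empty (List ℕ)
  ext x
  simp only [Set.mem_ofPred_eq, Set.mem_empty_iff_false, iff_false, List.length_eq_zero_iff]
  rintro ⟨h, rfl⟩
  exact h.1.ne_nil rfl

theorem numHereditary_succ (n : ℕ) : numHereditary (n + 1) = numWords n .start := by
  rw [numHereditary_eq, ncard_isHereditarySeq]

/-! ### Solving the linear system -/

section GeneratingFunction

open PowerSeries

/-- The generating function of the words starting from a representation of type `k`. -/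
noncomputable def wordGF (k : Kind) : PowerSeries ℚ := PowerSeries.mk fun n => (numWords n k : ℚ)

theorem hereditaryGF_eq : hereditaryGF = X * wordGF .start := by
  ext n
  rcases n with _ | n
  · simp [hereditaryGF, numHereditary_zero]
  · simp [hereditaryGF, numHereditary_succ, wordGF, coeff_succ_X_mul]

theorem wordGF_eq (k : Kind) :
    wordGF k = 1 + X * ((moves 0 0 k).map fun s => wordGF s.2).sum := by
  ext n
  rcases n with _ | n
  · simp [wordGF, numWords]
  · rw [map_add, coeff_succ_X_mul, coeff_one, if_neg (Nat.succ_ne_zero n), zero_add, map_list_sum,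
      List.map_map]
    simp only [wordGF, coeff_mk, numWords, Nat.cast_list_sum, List.map_map]
    exact congrArg List.sum (List.map_congr_left fun s _ => by simp)

theorem wordGF_start_mul :
    wordGF .start * (1 - X ^ 5 + 14 * X ^ 4 - 29 * X ^ 3 + 23 * X ^ 2 - 8 * X) =
      X ^ 4 - 9 * X ^ 3 + 12 * X ^ 2 - 6 * X + 1 := by
  have h0 := wordGF_eq .start
  have h1 := wordGF_eq .tight₀
  have h2 := wordGF_eq .tight₁
  have h3 := wordGF_eq .tight₂
  have h4 := wordGF_eq .loose
  have h5 := wordGF_eq .wide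
  have h6 := wordGF_eq .low₁
  have h7 := wordGF_eq .low₂
  simp only [moves, List.map_cons, List.map_nil, List.sum_cons, List.sum_nil]
    at h0 h1 h2 h3 h4 h5 h6 h7
  -- The combination of the eight equations that eliminates all unknowns but `wordGF .start` has
  -- polynomial weights only after multiplication by (1 - X) ^ 2.
  have hX : (1 - X : PowerSeries ℚ) ^ 2 ≠ 0 := by
    refine pow_ne_zero 2 fun h => ?_
    simpa using congrArg (constantCoeff (R := ℚ)) h
  refine mul_left_cancel₀ hX ?_
  linear_combination
    (1 - 9 * X + 31 * X ^ 2 - 52 * X ^ 3 + 43 * X ^ 4 - 15 * X ^ 5 + X ^ 6) * h0 +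
    (X - 7 * X ^ 2 + 18 * X ^ 3 - 21 * X ^ 4 + 10 * X ^ 5 - X ^ 6) * h1 +
    (X ^ 3 - 4 * X ^ 4 + 4 * X ^ 5) * h2 + (X ^ 5 - 2 * X ^ 6) * h3 + (X ^ 5 - X ^ 6) * h4 +
    X ^ 6 * h5 + (X ^ 2 - 6 * X ^ 3 + 12 * X ^ 4 - 9 * X ^ 5 + X ^ 6) * h6 +
    (X ^ 4 - 3 * X ^ 5 + 2 * X ^ 6) * h7

end GeneratingFunction

end SemiorderGF

theorem theorem4p1 :
    SemiorderGF.hereditaryGF =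
      ((PowerSeries.X ^ 5 - 9 * PowerSeries.X ^ 4 + 12 * PowerSeries.X ^ 3
          - 6 * PowerSeries.X ^ 2 + PowerSeries.X) *
        (1 - PowerSeries.X ^ 5 + 14 * PowerSeries.X ^ 4 - 29 * PowerSeries.X ^ 3
          + 23 * PowerSeries.X ^ 2 - 8 * PowerSeries.X)⁻¹ : PowerSeries ℚ) := by
  rw [PowerSeries.eq_mul_inv_iff_mul_eq (by simp), SemiorderGF.hereditaryGF_eq, mul_assoc,
    SemiorderGF.wordGF_start_mul]
  ring
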